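/- **The construction.** Let $G=(V,E)$ be a finite, undirected, unweighted graph with $n$ vertices and distance $\delta_G$ (with $\delta_G(u,v)=\infty$ if $u,v$ lie in different components), and let $K\ge 1$ be an integer (the depth). Put $S_0=V$; for $1\le i\le K-1$ let $S_i$ be obtained from $S_{i-1}$ by keeping each vertex independently with probability $n^{-1/K}$; put $S_K=\varnothing$. Let $\delta_G(u,S)=\min_{s\in S}\delta_G(u,s)$ ($\infty$ if $S=\varnothing$), and for $S_i\neq\varnothing$ let the pivot $p_i(u)$ be a vertex of $S_i$ nearest to $u$ (ties broken by an arbitrary fixed rule). Let - $D$ be the set of pairs $(u,p_i(u))$, $u\in V$, $1\le i\le K-1$; - $E_1$ be the set of edges $uv\in E$ with $1<\delta_G(u,S_1)$ or $1<\delta_G(v,S_1)$; - $B_j(A)$, for $A\subseteq V$, be the set of pairs $(u,s)$ with $u\in A$ such that, for some $i\ge 0$ with $i+j\le K-1$, $s\in S_i$ and $\delta_G(u,s)<\delta_G(u,S_{i+j})$. Let $F=D\cup E_1\cup B_1(V)\cup B_2(S_1)\cup\bigcup_{i=1}^{K}(S_{i-1}\times S_{K-i})$, and let $H=(V,F,w_H)$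 be the undirected weighted graph whose edges are the pairs $uv\in F$ with $u\ne v$ and $\delta_G(u,v)<\infty$, with weight $w_H(u,v)=\delta_G(u,v)$. An $(\alpha,\beta)$-emulator of $G$ is a weighted graph $H$ on $V$ with $\delta_G(u,v)\le\delta_H(u,v)\le\alpha\,\delta_G(u,v)+\beta$ for all $u,v\in V$; its size is its number of edges. **Theorem.** Let $k\ge 2$ be an integer, and apply the construction with depth $K=2^{k+1}-1$. 1. For every such $G$, every outcome of the sampling and every tie-breaking rule, $H$ is a $(2^{k+1}-3,\;2^{k+2}-4)$-emulator of $G$. 2. The expected size of $H$ is $\tilde O\big(n^{1+\frac{1}{2^{k+1}-1}}\big)$, i.e. at most $C\,n^{1+\frac1{2^{k+1}-1}}(\log n)^{c}$ with constants $C,c$ that depend only on $k$. 3. For all $u\neq v$ in $V$ with $\delta_G(u,v)\le\left\lfloor\frac{6^k-1}{2^{k+1}-4}\right\rfloor^{k}$, $$\delta_H(u,v)\le(2^{k+1}-3)\,\delta_G(u,v)+2^{k+2}-4\;<\;\delta_G(u,v)+(6^k-1)\,\delta_G(u,v)^{1-\frac1k},$$ that is, the guarantee of $H$ is strictly below the guarantee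 of the Thorup–Zwick $+(6^k-1)\delta^{1-1/k}$-emulator of the same size. Moreover, $\left\lfloor\frac{6^k-1}{2^{k+1}-4}\right\rfloor^{k}=O(3^{k^2})$ as $k\to\infty$, and for every $k\ge2$ the polynomial $f_k(x)=(2^{k+1}-4)x^k-(6^k-1)x^{k-1}+2^{k+2}-4$ has exactly one root $r_k$ in $(1,\infty)$; it satisfies $\frac{(k-1)(6^k-1)}{k(2^{k+1}-4)}<r_k<\frac{6^k-1}{2^{k+1}-4}$, and $f_k(x)<0$ for all $x\in(1,r_k)$. -/

import Mathlib

open MeasureTheory ProbabilityTheory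
open scoped ENNReal NNReal

noncomputable section

namespace Emulator

/-- An undirected graph on `V` whose edges carry strictly positive real weights. -/
structure WeightedGraph (V : Type*) where
  graph : SimpleGraph V
  weight : V → V → ℝ≥0
  weight_symm : ∀ u v, weight u v = weight v u
  weight_pos : ∀ u v, graph.Adj u v → 0 < weight u v

namespace WeightedGraph

variable {V : Type*} (H : WeightedGraph V)

/-- The weight of a walk: the sum of the weights of its edges. -/
def walkWeight {u v : V} (p : H.graph.Walk u v) : ℝ≥0 :=
  (p.darts.map fun d => H.weight d.fst d.snd).sum

/-- The distance in a weighted graph: the least weight of a walk, `∞` if there is none. -/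
def wdist (u v : V) : ℝ≥0∞ :=
  ⨅ p : H.graph.Walk u v, (H.walkWeight p : ℝ≥0∞)

/-- The size of a weighted graph: its number of edges. -/
def size : ℕ := H.graph.edgeSet.ncard

end WeightedGraph

/-- `H` is an `(α, β)`-emulator of the unweighted graph `G` on the same vertex set:
`δ_G(u,v) ≤ δ_H(u,v) ≤ α δ_G(u,v) + β` for all `u, v` (distances are `∞` between different
connected components). -/
def IsEmulator {V : Type*} (G : SimpleGraph V) (α β : ℝ≥0) (H : WeightedGraph V) : Prop :=
  ∀ u v : V, (G.edist u v : ℝ≥0∞) ≤ H.wdist u v ∧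
    H.wdist u v ≤ (α : ℝ≥0∞) * (G.edist u v : ℝ≥0∞) + (β : ℝ≥0∞)

section Construction

variable {V : Type*} (G : SimpleGraph V)

/-- The distance `δ(u, S)` from a vertex to a set (`∞` if no vertex of `S` can be reached). -/
def setDist (u : V) (S : Set V) : ℕ∞ := ⨅ s ∈ S, G.edist u s

/-- A pivot rule chooses, for every nonempty vertex set `S` and every vertex `u`, a vertex of `S`
that is nearest to `u`; ties are broken in an arbitrary but fixed way. -/
def IsPivotRule (pivot : Set V → V → V) : Prop :=
  ∀ (S : Set V) (u : V), S.Nonempty → pivot S u ∈ S ∧ G.edist u (pivot S u) = setDist G u S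

/-- The members of `A` that are strictly closer to `u` than the pivot of `u` in `S`. -/
def ball (u : V) (A S : Set V) : Set V := {a | a ∈ A ∧ G.edist u a < setDist G u S}

/-- Outcomes of the coin flips for a hierarchy of depth `K`: the coin `ω (i, v)` decides whether
`v` is kept when passing from `S_i` to `S_{i+1}`, for `0 ≤ i < K - 1`. -/
abbrev Coins (V : Type*) (K : ℕ) : Type _ := Fin (K - 1) × V → Bool

/-- The hierarchy `V = S_0 ⊇ S_1 ⊇ ... ⊇ S_{K-1} ⊇ S_K = ∅` given by the coin flips. -/
def level {K : ℕ} (ω : Coins V K) (i : ℕ) : Set V :=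
  {v | i < K ∧ ∀ j : Fin (K - 1), (j : ℕ) < i → ω (j, v) = true}

/-- The pairs `(u, p_i(u))`, `1 ≤ i ≤ K - 1`. -/
def pivotPairs (pivot : Set V → V → V) {K : ℕ} (ω : Coins V K) : Set (V × V) :=
  {e | ∃ i ∈ Finset.Icc 1 (K - 1), (level ω i).Nonempty ∧ e.2 = pivot (level ω i) e.1}

/-- `E_1`: the edges of `G` (all of weight one) that are shorter than the distance from one of
their endpoints to `S_1`. -/
def nearEdges {K : ℕ} (ω : Coins V K) : Set (V × V) :=
  {e | G.Adj e.1 e.2 ∧ (1 < setDist G e.1 (level ω 1) ∨ 1 < setDist G e.2 (level ω 1))}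

/-- `B_j(A)`: the pairs `(u, s)` with `u ∈ A` and `s` in the ball of `u` with respect to
`S_i` and `S_{i+j}`, for some `i ≥ 0` with `i + j ≤ K - 1`. -/
def bunchPairs {K : ℕ} (ω : Coins V K) (j : ℕ) (A : Set V) : Set (V × V) :=
  {e | e.1 ∈ A ∧ ∃ i : ℕ, i + j ≤ K - 1 ∧ e.2 ∈ ball G e.1 (level ω i) (level ω (i + j))}

/-- The union of the products `S_{i-1} × S_{K-i}` for `1 ≤ i ≤ K`. -/
def productPairs {K : ℕ} (ω : Coins V K) : Set (V × V) :=
  ⋃ i ∈ Finset.Icc 1 K, level ω (i - 1) ×ˢ level ω (K - i)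

/-- `F = D ∪ E_1 ∪ B_1(V) ∪ B_2(S_1) ∪ ⋃ S_{i-1} × S_{K-i}`. -/
def emulatorPairs (pivot : Set V → V → V) {K : ℕ} (ω : Coins V K) : Set (V × V) :=
  pivotPairs pivot ω ∪ nearEdges G ω ∪ bunchPairs G ω 1 Set.univ ∪
    bunchPairs G ω 2 (level ω 1) ∪ productPairs ω

/-- The construction of depth `K`: the pairs of `F` become undirected edges `uv` of weight
`δ_G(u,v)`. Loops, and pairs at infinite distance, are left out. -/
def construction (pivot : Set V → V → V) {K : ℕ} (ω : Coins V K) : WeightedGraph V where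
  graph :=
    { Adj := fun u v => u ≠ v ∧ G.Reachable u v ∧
        ((u, v) ∈ emulatorPairs G pivot ω ∨ (v, u) ∈ emulatorPairs G pivot ω)
      symm := ⟨fun _ _ h => ⟨h.1.symm, h.2.1.symm, h.2.2.symm⟩⟩
      loopless := ⟨fun _ h => h.1 rfl⟩ }
  weight := fun u v => (G.dist u v : ℝ≥0)
  weight_symm := fun u v => by rw [G.dist_comm]
  weight_pos := fun u v h => by
    have := h.2.1.pos_dist_of_ne h.1
    exact_mod_cast this

end Construction

/-- The sampling probability `n ^ (-1/K)`. -/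
def sampleProb (n K : ℕ) : unitInterval :=
  ⟨(n : ℝ) ^ (-(1 / (K : ℝ))), by positivity, by
    rcases Nat.eq_zero_or_pos n with rfl | hn
    · rcases eq_or_ne (K : ℝ) 0 with h | h
      · simp [h]
      · rw [Nat.cast_zero, Real.zero_rpow (by simpa using h)]
        exact zero_le_one
    · exact Real.rpow_le_one_of_one_le_of_nonpos (by exact_mod_cast hn)
        (neg_nonpos.mpr (by positivity))⟩

/-- The law of the coin flips: independent, each equal to `true` with probability `n ^ (-1/K)`,
where `n` is the number of vertices. -/
def coinMeasure (V : Type*) [Fintype V] (K : ℕ) : Measure (Coins V K) :=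
  Measure.pi fun _ => bernoulliMeasure true false (sampleProb (Fintype.card V) K)

/-- The expected number of edges of the construction of depth `K`. -/
def expectedSize {V : Type*} [Fintype V] (G : SimpleGraph V) (pivot : Set V → V → V) (K : ℕ) : ℝ :=
  ∫ ω, ((construction G pivot ω).size : ℝ) ∂(coinMeasure V K)

/-- The distance threshold `⌊(6^k - 1) / (2^(k+1) - 4)⌋ ^ k`. -/
def threshold (k : ℕ) : ℕ := ⌊((6 : ℝ) ^ k - 1) / ((2 : ℝ) ^ (k + 1) - 4)⌋₊ ^ k

/-- The polynomial `f_k(x) = (2^(k+1) - 4) x^k - (6^k - 1) x^(k-1) + 2^(k+2) - 4`. -/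
def comparisonPoly (k : ℕ) (x : ℝ) : ℝ :=
  ((2 : ℝ) ^ (k + 1) - 4) * x ^ k - ((6 : ℝ) ^ k - 1) * x ^ (k - 1) + (2 : ℝ) ^ (k + 2) - 4

end Emulator

end

/-! Write `p` for the sampling probability and `δ` for distance in `G`. The lower bound on distances
in `H` is the triangle inequality, since every edge weighs exactly the distance it spans.

Upper bound, for `K = 2m + 3`. Let `x, y ∈ S_1` be at distance at most `d`, and let `s` be the pivot
of `x` in `S_i`, at distance at most `a`. Either `s` lies in the ball of `y` below `S_{i+2}`, so
that `B_2(S_1)` gives the walk `x, s, y` of weight at most `2a + d`, or `δ(y, S_{i+2}) ≤ a + d`.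
With the roles also exchanged, each round raises the level by 2 and the radius by `d`. After `m`
rounds divided between the two ends, the two pivot levels add up to `K - 1`, and a product pair
joins the pivots, for a total of `(2m + 1)d = (K - 2)d`. For arbitrary `u, v`, cut a shortest walk
at its first and last edges outside `E_1`. The outer endpoints are within 1 of `S_1`, so passing to
their pivots lengthens the middle part by at most 2, costing `2(K - 2) + 2 = 2K - 2` extra.

Size: with `q = 1/p = n^(1/K)`, each kind of pair contributes O(K q n) in expectation. Near edges
and bunches are controlled by geometric sums with value at most `1/p`; the products by `p^(K-1) n² =
q n`. No logarithm arises.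

Comparison: with `x = d^(1/k)` the inequality becomes `f_k(x) < 0`, and `f_k` starts negative at 1,
decreases, then increases. -/

namespace Emulator

/-! ### Shape and sign of the comparison polynomial. -/

section ComparisonPolynomial

lemma two_pow_facts {k : ℕ} (hk : 2 ≤ k) :
    (0 : ℝ) < 2 ^ (k + 1) - 4 ∧ (0 : ℝ) < 2 ^ (k + 2) - 4 ∧
      2 * ((2 : ℝ) ^ (k + 1) - 4) + 4 < 6 ^ k - 1 := by
  obtain ⟨j, rfl⟩ := Nat.exists_eq_add_of_le' hk
  have h1 : (1 : ℝ) ≤ 2 ^ j := one_le_pow₀ (by norm_num)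
  have h2 : (2 : ℝ) ^ j ≤ 6 ^ j := pow_le_pow_left₀ (by norm_num) (by norm_num) j
  simp only [pow_add]
  refine ⟨?_, ?_, ?_⟩ <;> nlinarith

/-- The minimiser of the comparison polynomial on the positive reals. -/
noncomputable def criticalPoint (k : ℕ) : ℝ :=
  ((k : ℝ) - 1) * ((6 : ℝ) ^ k - 1) / (k * ((2 : ℝ) ^ (k + 1) - 4))

lemma one_lt_criticalPoint {k : ℕ} (hk : 2 ≤ k) : 1 < criticalPoint k := by
  obtain ⟨hA, -, hc⟩ := two_pow_facts hk
  have hk' : (2 : ℝ) ≤ k := by exact_mod_cast hk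
  rw [criticalPoint, one_lt_div (by positivity)]
  nlinarith

lemma criticalPoint_lt {k : ℕ} (hk : 2 ≤ k) :
    criticalPoint k < ((6 : ℝ) ^ k - 1) / ((2 : ℝ) ^ (k + 1) - 4) := by
  obtain ⟨hA, -, hc⟩ := two_pow_facts hk
  have hk' : (2 : ℝ) ≤ k := by exact_mod_cast hk
  rw [criticalPoint, div_lt_div_iff₀ (by positivity) hA]
  nlinarith [mul_pos hA (by linarith : (0 : ℝ) < 6 ^ k - 1)]

lemma hasDerivAt_comparisonPoly {k : ℕ} (hk : 2 ≤ k) (x : ℝ) :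
    HasDerivAt (comparisonPoly k)
      (k * ((2 : ℝ) ^ (k + 1) - 4) * x ^ (k - 2) * (x - criticalPoint k)) x := by
  obtain ⟨hA, -, hc⟩ := two_pow_facts hk
  have h := ((((hasDerivAt_pow k x).const_mul ((2 : ℝ) ^ (k + 1) - 4)).sub
    ((hasDerivAt_pow (k - 1) x).const_mul ((6 : ℝ) ^ k - 1))).add_const
      ((2 : ℝ) ^ (k + 2))).sub_const 4
  refine h.congr_deriv ?_
  obtain ⟨j, rfl⟩ := Nat.exists_eq_add_of_le' hk
  have hj : ((j + 2 : ℕ) : ℝ) ≠ 0 := by positivity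
  have e1 : j + 2 - 1 = j + 1 := rfl
  have e2 : j + 2 - 2 = j := rfl
  have e3 : j + 2 - 1 - 1 = j := rfl
  have hx : ((j + 2 : ℕ) : ℝ) * ((2 : ℝ) ^ (j + 2 + 1) - 4) * criticalPoint (j + 2) =
      ((j + 2 : ℕ) - 1 : ℝ) * ((6 : ℝ) ^ (j + 2) - 1) := by
    rw [criticalPoint, mul_div_cancel₀]
    exact mul_ne_zero hj hA.ne'
  rw [e3, e1, e2, mul_sub, mul_right_comm _ _ (criticalPoint _), hx]
  push_cast
  ring

lemma strictAntiOn_comparisonPoly {k : ℕ} (hk : 2 ≤ k) :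
    StrictAntiOn (comparisonPoly k) (Set.Icc 1 (criticalPoint k)) := by
  obtain ⟨hA, -, -⟩ := two_pow_facts hk
  refine strictAntiOn_of_deriv_neg (convex_Icc _ _)
    (fun x _ => (hasDerivAt_comparisonPoly hk x).continuousAt.continuousWithinAt) fun x hx => ?_
  rw [interior_Icc] at hx
  rw [(hasDerivAt_comparisonPoly hk x).deriv]
  have : 0 < x := by linarith [hx.1]
  have : (0 : ℝ) < k := by positivity
  exact mul_neg_of_pos_of_neg (by positivity) (by linarith [hx.2])

lemma strictMonoOn_comparisonPoly {k : ℕ} (hk : 2 ≤ k) :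
    StrictMonoOn (comparisonPoly k) (Set.Ici (criticalPoint k)) := by
  obtain ⟨hA, -, -⟩ := two_pow_facts hk
  have h1 := one_lt_criticalPoint hk
  refine strictMonoOn_of_deriv_pos (convex_Ici _)
    (fun x _ => (hasDerivAt_comparisonPoly hk x).continuousAt.continuousWithinAt) fun x hx => ?_
  rw [interior_Ici] at hx
  have hx' : criticalPoint k < x := hx
  rw [(hasDerivAt_comparisonPoly hk x).deriv]
  have : 0 < x := by linarith
  have : (0 : ℝ) < k := by positivity
  exact mul_pos (by positivity) (by linarith)

lemma comparisonPoly_one_neg {k : ℕ} (hk : 2 ≤ k) : comparisonPoly k 1 < 0 := by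
  obtain ⟨j, rfl⟩ := Nat.exists_eq_add_of_le' hk
  have h1 : (1 : ℝ) ≤ 2 ^ j := one_le_pow₀ (by norm_num)
  have h2 : (2 : ℝ) ^ j ≤ 6 ^ j := pow_le_pow_left₀ (by norm_num) (by norm_num) j
  simp only [comparisonPoly, pow_add, one_pow]
  nlinarith

lemma comparisonPoly_eq_mul {k : ℕ} (hk : 2 ≤ k) (x : ℝ) :
    comparisonPoly k x =
      x ^ (k - 1) * (((2 : ℝ) ^ (k + 1) - 4) * x - ((6 : ℝ) ^ k - 1)) + (2 ^ (k + 2) - 4) := by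
  obtain ⟨j, rfl⟩ := Nat.exists_eq_add_of_le' hk
  simp only [comparisonPoly, show j + 2 - 1 = j + 1 from rfl]
  ring

lemma comparisonPoly_neg_of_mem_Icc {k : ℕ} (hk : 2 ≤ k) {x y : ℝ} (hy : comparisonPoly k y < 0)
    (hx : x ∈ Set.Icc 1 y) : comparisonPoly k x < 0 := by
  rcases le_total x (criticalPoint k) with h | h
  · exact ((strictAntiOn_comparisonPoly hk).antitoneOn
      ⟨le_rfl, (one_lt_criticalPoint hk).le⟩ ⟨hx.1, h⟩ hx.1).trans_lt (comparisonPoly_one_neg hk)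
  · exact ((strictMonoOn_comparisonPoly hk).monotoneOn h (h.trans hx.2) hx.2).trans_lt hy

/-- At the upper endpoint the two leading terms cancel, leaving `2^(k+2) - 4 > 0`. Up to the
critical point the values stay below `f_k(1) < 0`; beyond it monotonicity gives exactly one zero. -/
lemma exists_root_comparisonPoly {k : ℕ} (hk : 2 ≤ k) : ∃ r : ℝ,
    r ∈ Set.Ioo (((k : ℝ) - 1) * ((6 : ℝ) ^ k - 1) / (k * ((2 : ℝ) ^ (k + 1) - 4)))
      (((6 : ℝ) ^ k - 1) / ((2 : ℝ) ^ (k + 1) - 4)) ∧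
    1 < r ∧ comparisonPoly k r = 0 ∧
    (∀ x : ℝ, 1 < x → comparisonPoly k x = 0 → x = r) ∧
    (∀ x ∈ Set.Ioo 1 r, comparisonPoly k x < 0) := by
  obtain ⟨hA, hB, hc⟩ := two_pow_facts hk
  have h1 := one_lt_criticalPoint hk
  have h2 := criticalPoint_lt hk
  have hneg : ∀ x ∈ Set.Icc 1 (criticalPoint k), comparisonPoly k x < 0 := fun x hx =>
    ((strictAntiOn_comparisonPoly hk).antitoneOn ⟨le_rfl, h1.le⟩ hx hx.1).trans_lt
      (comparisonPoly_one_neg hk)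
  have hpos : 0 < comparisonPoly k (((6 : ℝ) ^ k - 1) / ((2 : ℝ) ^ (k + 1) - 4)) := by
    rw [comparisonPoly_eq_mul hk, mul_div_cancel₀ _ hA.ne', sub_self, mul_zero, zero_add]
    exact hB
  obtain ⟨r, hr, hr0⟩ := intermediate_value_Ioo h2.le
    (fun x _ => (hasDerivAt_comparisonPoly hk x).continuousAt.continuousWithinAt)
    (show (0 : ℝ) ∈ Set.Ioo _ _ from ⟨hneg _ ⟨h1.le, le_rfl⟩, hpos⟩)
  refine ⟨r, hr, h1.trans hr.1, hr0, fun x hx hx0 => ?_, fun x hx => ?_⟩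
  · rcases le_total x (criticalPoint k) with h | h
    · exact absurd hx0 (hneg x ⟨hx.le, h⟩).ne
    · exact (strictMonoOn_comparisonPoly hk).injOn h hr.1.le (hx0.trans hr0.symm)
  · rcases le_total x (criticalPoint k) with h | h
    · exact hneg x ⟨hx.1.le, h⟩
    · exact hr0 ▸ strictMonoOn_comparisonPoly hk h hr.1.le hx.2

lemma comparisonPoly_floor_neg {k : ℕ} (hk : 2 ≤ k) :
    comparisonPoly k (⌊((6 : ℝ) ^ k - 1) / ((2 : ℝ) ^ (k + 1) - 4)⌋₊ : ℝ) < 0 := by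
  obtain ⟨hA, hB, hc⟩ := two_pow_facts hk
  set m := ⌊((6 : ℝ) ^ k - 1) / ((2 : ℝ) ^ (k + 1) - 4)⌋₊ with hm
  have hle : (m : ℝ) * (2 ^ (k + 1) - 4) ≤ 6 ^ k - 1 :=
    (le_div_iff₀ hA).1 (Nat.floor_le (div_nonneg (by linarith) hA.le))
  -- the numerator is odd and the denominator even, so the division leaves a remainder
  have hlt : (m : ℝ) * (2 ^ (k + 1) - 4) + 1 ≤ 6 ^ k - 1 := by
    have hne : (m : ℤ) * (2 ^ (k + 1) - 4) ≠ 6 ^ k - 1 := by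
      intro h
      obtain ⟨j, rfl⟩ := Nat.exists_eq_add_of_le' hk
      have : (6 : ℤ) ^ (j + 2) = 2 * (3 * 6 ^ (j + 1)) := by ring
      have h2 : (m : ℤ) * (2 ^ (j + 2 + 1) - 4) = 2 * (m * (2 ^ (j + 2) - 2)) := by ring
      omega
    have hle' : (m : ℤ) * (2 ^ (k + 1) - 4) ≤ 6 ^ k - 1 := by exact_mod_cast hle
    have := lt_of_le_of_ne hle' hne
    exact_mod_cast (Int.add_one_le_iff.2 this)
  -- For `k ≥ 3` the remainder of at least 1 makes the value at `m` at most `-m^(k-1) + 2^(k+2) -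
  -- 4`, and `m ≥ 8` makes the power win.
  have h8 : 8 ≤ m := by
    rw [hm]
    refine Nat.le_floor ?_
    rw [le_div_iff₀ hA]
    obtain ⟨j, rfl⟩ := Nat.exists_eq_add_of_le' hk
    have h1 : (1 : ℝ) ≤ 2 ^ j := one_le_pow₀ (by norm_num)
    have h2 : 1 + (j : ℝ) * 2 ≤ 3 ^ j := by
      have := one_add_mul_le_pow (show (-2 : ℝ) ≤ 2 by norm_num) j
      norm_num at this ⊢; linarith
    have h3 : (6 : ℝ) ^ j = 2 ^ j * 3 ^ j := by rw [← mul_pow]; norm_num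
    simp only [pow_add, h3]
    rcases Nat.eq_zero_or_pos j with rfl | hj
    · norm_num
    · have : (1 : ℝ) ≤ j := by exact_mod_cast hj
      push_cast
      nlinarith
  rw [comparisonPoly_eq_mul hk]
  -- For `k = 2` a remainder of 1 would not suffice (`-8 + 12 > 0`); the true remainder `35 - 4·8 =
  -- 3` does.
  rcases hk.eq_or_lt with rfl | hk3
  · have hm8 : m = 8 := by
      rw [hm, Nat.floor_eq_iff (by norm_num)]
      norm_num
    rw [hm8]
    norm_num
  · obtain ⟨j, rfl⟩ := Nat.exists_eq_add_of_le' (show 3 ≤ k from hk3)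
    have h8' : (8 : ℝ) ^ (j + 2) ≤ (m : ℝ) ^ (j + 2) :=
      pow_le_pow_left₀ (by norm_num) (by exact_mod_cast h8) _
    have h2 : (2 : ℝ) ^ j ≤ 8 ^ j := pow_le_pow_left₀ (by norm_num) (by norm_num) j
    have h1 : (1 : ℝ) ≤ 2 ^ j := one_le_pow₀ (by norm_num)
    have h4 : (2 : ℝ) ^ (j + 3 + 2) ≤ 8 ^ (j + 2) := by
      simp only [pow_add]; nlinarith
    have hp : (0 : ℝ) ≤ (m : ℝ) ^ (j + 2) := by positivity
    rw [show j + 3 - 1 = j + 2 from rfl]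
    nlinarith

lemma comparison_lt_of_le_threshold {k : ℕ} (hk : 2 ≤ k) {d : ℕ} (hd : 1 ≤ d)
    (hdk : d ≤ threshold k) :
    ((2 : ℝ) ^ (k + 1) - 3) * d + ((2 : ℝ) ^ (k + 2) - 4) <
      d + ((6 : ℝ) ^ k - 1) * (d : ℝ) ^ (1 - 1 / (k : ℝ)) := by
  have hk0 : k ≠ 0 := by omega
  set x : ℝ := (d : ℝ) ^ (1 / (k : ℝ)) with hx
  have hd' : (1 : ℝ) ≤ d := by exact_mod_cast hd
  have hd0 : (0 : ℝ) < d := by linarith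
  have hx1 : 1 ≤ x := Real.one_le_rpow hd' (by positivity)
  have hxk : x ^ k = d := by
    rw [hx, one_div, Real.rpow_inv_natCast_pow hd0.le hk0]
  have hxk1 : (d : ℝ) ^ (1 - 1 / (k : ℝ)) = x ^ (k - 1) := by
    rw [hx, ← Real.rpow_natCast, ← Real.rpow_mul hd0.le, Nat.cast_sub (by omega)]
    congr 1
    have : (k : ℝ) ≠ 0 := by exact_mod_cast hk0
    field_simp
    simp
  have hxm : x ≤ (⌊((6 : ℝ) ^ k - 1) / ((2 : ℝ) ^ (k + 1) - 4)⌋₊ : ℝ) := by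
    refine le_of_pow_le_pow_left₀ hk0 (by positivity) ?_
    rw [hxk, ← Nat.cast_pow]
    exact Nat.cast_le.2 hdk
  have := comparisonPoly_neg_of_mem_Icc hk (comparisonPoly_floor_neg hk) ⟨hx1, hxm⟩
  rw [comparisonPoly, hxk] at this
  rw [hxk1]
  linarith

lemma threshold_isBigO :
    (fun k : ℕ => (threshold k : ℝ)) =O[Filter.atTop] (fun k : ℕ => (3 : ℝ) ^ (k ^ 2)) := by
  refine Asymptotics.IsBigO.of_bound 1 ?_
  filter_upwards [Filter.eventually_ge_atTop 2] with k hk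
  obtain ⟨hA, -, hc⟩ := two_pow_facts hk
  rw [one_mul, Real.norm_of_nonneg (by positivity), Real.norm_of_nonneg (by positivity), threshold,
    sq, pow_mul, Nat.cast_pow]
  refine pow_le_pow_left₀ (by positivity) ?_ k
  -- The implied constant is 1: `2^(k+1) - 4 ≥ 2^k` bounds the quotient by `3^k`.
  refine (Nat.floor_le (div_nonneg (by linarith) hA.le)).trans ?_
  rw [div_le_iff₀ hA]
  have h3 : (6 : ℝ) ^ k = 3 ^ k * 2 ^ k := by rw [← mul_pow]; norm_num
  have h4 : (4 : ℝ) ≤ 2 ^ k := by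
    calc (4 : ℝ) = 2 ^ 2 := by norm_num
      _ ≤ 2 ^ k := pow_le_pow_right₀ (by norm_num) hk
  rw [h3, pow_succ]
  nlinarith [pow_pos (show (0 : ℝ) < 3 by norm_num) k]

end ComparisonPolynomial

/-! ### Weighted distance as a pseudometric. -/

namespace WeightedGraph

variable {V : Type*} (H : WeightedGraph V)

lemma wdist_self (u : V) : H.wdist u u = 0 :=
  le_antisymm (iInf_le_of_le SimpleGraph.Walk.nil (by simp [walkWeight])) zero_le

lemma walkWeight_cons {u v w : V} (h : H.graph.Adj u v) (p : H.graph.Walk v w) :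
    H.walkWeight (SimpleGraph.Walk.cons h p) = H.weight u v + H.walkWeight p := by
  simp [walkWeight]

lemma walkWeight_append {u v w : V} (p : H.graph.Walk u v) (q : H.graph.Walk v w) :
    H.walkWeight (p.append q) = H.walkWeight p + H.walkWeight q := by
  simp [walkWeight]

lemma walkWeight_reverse {u v : V} (p : H.graph.Walk u v) :
    H.walkWeight p.reverse = H.walkWeight p := by
  induction p with
  | nil => rfl
  | cons h p ih =>
    rw [SimpleGraph.Walk.reverse_cons, walkWeight_append, ih, walkWeight_cons, walkWeight_cons,
      H.weight_symm, add_comm]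
    simp [walkWeight]

lemma wdist_triangle (u v w : V) : H.wdist u w ≤ H.wdist u v + H.wdist v w := by
  refine ENNReal.le_iInf_add_iInf fun p q => ?_
  refine iInf_le_of_le (p.append q) ?_
  rw [walkWeight_append, ENNReal.coe_add]

lemma wdist_comm (u v : V) : H.wdist u v = H.wdist v u := by
  have key : ∀ a b : V, H.wdist a b ≤ H.wdist b a := fun a b =>
    le_iInf fun p => iInf_le_of_le p.reverse (by rw [walkWeight_reverse])
  exact le_antisymm (key u v) (key v u)

lemma wdist_le_weight {u v : V} (h : H.graph.Adj u v) : H.wdist u v ≤ H.weight u v :=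
  iInf_le_of_le h.toWalk (by simp [walkWeight])

end WeightedGraph

/-! ### Stretch of the construction, for every outcome of the coins. -/

section Stretch

variable {V : Type*} (G : SimpleGraph V)

lemma coe_edist_eq_coe_dist {u v : V} (h : G.Reachable u v) :
    ((G.edist u v : ℕ∞) : ℝ≥0∞) = (G.dist u v : ℝ≥0∞) := by
  rw [← h.coe_dist_eq_edist]; simp

lemma setDist_le_edist {u s : V} {S : Set V} (h : s ∈ S) : setDist G u S ≤ G.edist u s :=
  iInf₂_le s h

lemma setDist_empty (u : V) : setDist G u ∅ = ⊤ := by simp [setDist]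

lemma level_zero {K : ℕ} (hK : 0 < K) (ω : Coins V K) : level ω 0 = Set.univ := by
  ext v; simp [level, hK]

section

variable (pivot : Set V → V → V) {K : ℕ} (ω : Coins V K)

lemma edist_le_wdist (u v : V) : (G.edist u v : ℝ≥0∞) ≤ (construction G pivot ω).wdist u v := by
  refine le_iInf fun p => ?_
  induction p with
  | nil => simp
  | @cons a b c h p ih =>
    rw [WeightedGraph.walkWeight_cons, ENNReal.coe_add]
    refine le_trans ?_ (add_le_add_right ih _)
    have hw : (((construction G pivot ω).weight a b : ℝ≥0) : ℝ≥0∞) = (G.edist a b : ℝ≥0∞) := by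
      rw [coe_edist_eq_coe_dist G h.2.1]; simp [construction]
    rw [hw]
    exact_mod_cast G.edist_triangle

/-- The pairs left out of `H` satisfy the bound trivially, so every pair of `F` can be used as an
edge. -/
lemma wdist_le_edist {u v : V} (h : (u, v) ∈ emulatorPairs G pivot ω) :
    (construction G pivot ω).wdist u v ≤ (G.edist u v : ℝ≥0∞) := by
  rcases eq_or_ne u v with rfl | huv
  · simp [WeightedGraph.wdist_self]
  by_cases hr : G.Reachable u v
  · refine (WeightedGraph.wdist_le_weight _ (show (construction G pivot ω).graph.Adj u v from
      ⟨huv, hr, Or.inl h⟩)).trans ?_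
    rw [coe_edist_eq_coe_dist G hr]
    simp [construction]
  · simp [SimpleGraph.edist_eq_top_of_not_reachable hr]

lemma nearEdges_subset : nearEdges G ω ⊆ emulatorPairs G pivot ω := fun _ h =>
  Or.inl (Or.inl (Or.inl (Or.inr h)))

variable {pivot}

lemma IsPivotRule.wdist_pivot_le (hp : IsPivotRule G pivot) {i : ℕ} (hi : 1 ≤ i) (hiK : i ≤ K - 1)
    (hne : (level ω i).Nonempty) (u : V) :
    (construction G pivot ω).wdist u (pivot (level ω i) u) ≤ (setDist G u (level ω i) : ℝ≥0∞) := by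
  rw [← (hp _ u hne).2]
  exact wdist_le_edist G pivot ω
    (Or.inl (Or.inl (Or.inl (Or.inl ⟨i, Finset.mem_Icc.2 ⟨hi, hiK⟩, hne, rfl⟩))))

/-- The distance to an empty level is `⊤`, so a finite bound is all that is needed before taking a
pivot. -/
lemma level_nonempty_of_setDist_le {u : V} {i a : ℕ} (h : setDist G u (level ω i) ≤ a) :
    (level ω i).Nonempty := by
  rw [Set.nonempty_iff_ne_empty]
  rintro he
  rw [he, setDist_empty] at h
  exact absurd h (by simp)

/-- Two sampled vertices `x`, `y`: either the pivot of `x` in level `i` is joined to `y`, or the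
distance from `y` to level `i + 2` is small. -/
lemma wdist_le_or_setDist_le (hp : IsPivotRule G pivot) {x y : V} (hy : y ∈ level ω 1) {i a d : ℕ}
    (hi : 1 ≤ i) (hiK : i + 2 ≤ K - 1) (ha : setDist G x (level ω i) ≤ a)
    (hd : G.edist x y ≤ d) :
    (construction G pivot ω).wdist x y ≤ ((2 * a + d : ℕ) : ℝ≥0∞) ∨
      setDist G y (level ω (i + 2)) ≤ ((d + a : ℕ) : ℕ∞) := by
  have hne := level_nonempty_of_setDist_le G ω ha
  set s := pivot (level ω i) x with hs
  obtain ⟨hsi, hsd⟩ := hp (level ω i) x hne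
  have hys : G.edist y s ≤ ((d + a : ℕ) : ℕ∞) := by
    refine (G.edist_triangle (v := x)).trans ?_
    rw [Nat.cast_add]
    exact add_le_add (G.edist_comm ▸ hd) (hsd.trans_le ha)
  rcases lt_or_ge (G.edist y s) (setDist G y (level ω (i + 2))) with h | h
  · left
    have hmem : (y, s) ∈ emulatorPairs G pivot ω :=
      Or.inl (Or.inr ⟨hy, i, hiK, hsi, h⟩)
    have h1 : (construction G pivot ω).wdist x s ≤ (a : ℝ≥0∞) :=
      (hp.wdist_pivot_le G ω hi (by omega) hne x).trans (by exact_mod_cast ha)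
    have h2 : (construction G pivot ω).wdist s y ≤ ((d + a : ℕ) : ℝ≥0∞) := by
      rw [WeightedGraph.wdist_comm]
      exact (wdist_le_edist G pivot ω hmem).trans (by exact_mod_cast hys)
    refine (WeightedGraph.wdist_triangle _ x s y).trans ((add_le_add h1 h2).trans ?_)
    exact_mod_cast (by omega : a + (d + a) ≤ 2 * a + d)
  · exact Or.inr (h.trans hys)

/-- Iterates the dichotomy from both ends at once: each end's new radius uses the other end's old
one. An exit at round `j` costs `(2j + 1)d`, within the allowance. -/
lemma setDist_le_mul_or_wdist_le (hp : IsPivotRule G pivot) {x y : V} (hx : x ∈ level ω 1)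
    (hy : y ∈ level ω 1) {d : ℕ} (hd : G.edist x y ≤ d) (j : ℕ) (hj : 2 * j + 2 ≤ K - 1) :
    (construction G pivot ω).wdist x y ≤ (((K - 2) * d : ℕ) : ℝ≥0∞) ∨
      (setDist G x (level ω (2 * j + 1)) ≤ ((j * d : ℕ) : ℕ∞) ∧
        setDist G y (level ω (2 * j + 1)) ≤ ((j * d : ℕ) : ℕ∞)) := by
  induction j with
  | zero =>
    right
    have h0 : ∀ z ∈ level ω 1, setDist G z (level ω (2 * 0 + 1)) ≤ ((0 * d : ℕ) : ℕ∞) :=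
      fun z hz => (setDist_le_edist G (u := z) (S := level ω (2 * 0 + 1)) hz).trans (by simp)
    exact ⟨h0 x hx, h0 y hy⟩
  | succ j ih =>
    rcases ih (by omega) with h | ⟨hxj, hyj⟩
    · exact Or.inl h
    have hbound : 2 * (j * d) + d ≤ (K - 2) * d := by
      obtain ⟨m, hm⟩ := Nat.exists_eq_add_of_le (show 2 * j + 1 ≤ K - 2 by omega)
      rw [hm]; nlinarith
    have hstep : d + j * d = (j + 1) * d := by ring
    rcases wdist_le_or_setDist_le G ω hp hy (by omega) (by omega) hxj hd with h | hy'
    · exact Or.inl (h.trans (by exact_mod_cast hbound))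
    rcases wdist_le_or_setDist_le G ω hp hx (by omega) (by omega) hyj (G.edist_comm ▸ hd)
      with h | hx'
    · rw [WeightedGraph.wdist_comm] at h
      exact Or.inl (h.trans (by exact_mod_cast hbound))
    rw [hstep] at hx' hy'
    exact Or.inr ⟨hx', hy'⟩

/-- The stretch between two vertices of the first level, for odd depth. -/
lemma wdist_le_of_mem_level_one (hp : IsPivotRule G pivot) {m : ℕ} (hK : K = 2 * m + 3) {x y : V}
    (hx : x ∈ level ω 1) (hy : y ∈ level ω 1) {d : ℕ} (hd : G.edist x y ≤ d) :
    (construction G pivot ω).wdist x y ≤ (((K - 2) * d : ℕ) : ℝ≥0∞) := by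
  -- The rounds are shared as `m = (m - m / 2) + m / 2`, so the pivot levels `i` and `l` satisfy `i
  -- + l = 2m + 2 = K - 1`. Any other split of `m` would give the same total weight.
  rcases setDist_le_mul_or_wdist_le G ω hp hx hy hd (m - m / 2) (by omega) with h | ⟨hxi, -⟩
  · exact h
  rcases setDist_le_mul_or_wdist_le G ω hp hx hy hd (m / 2) (by omega) with h | ⟨-, hyi⟩
  · exact h
  set i := 2 * (m - m / 2) + 1 with hi
  set l := 2 * (m / 2) + 1 with hl
  have hne := level_nonempty_of_setDist_le G ω hxi
  have hne' := level_nonempty_of_setDist_le G ω hyi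
  set s := pivot (level ω i) x with hs
  set t := pivot (level ω l) y with ht
  obtain ⟨hsi, hsd⟩ := hp (level ω i) x hne
  obtain ⟨hti, htd⟩ := hp (level ω l) y hne'
  have hst : (s, t) ∈ emulatorPairs G pivot ω := by
    refine Or.inr (Set.mem_biUnion (x := i + 1) (by simp; omega) ⟨?_, ?_⟩)
    · exact hsi
    · rw [show K - (i + 1) = l by omega]
      exact hti
  have h1 := (hp.wdist_pivot_le G ω (by omega) (by omega) hne x).trans
    (show (setDist G x (level ω i) : ℝ≥0∞) ≤ ((((m - m / 2) * d : ℕ) : ℕ∞) : ℝ≥0∞) by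
      exact_mod_cast hxi)
  have h3 := (hp.wdist_pivot_le G ω (by omega) (by omega) hne' y).trans
    (show (setDist G y (level ω l) : ℝ≥0∞) ≤ ((((m / 2) * d : ℕ) : ℕ∞) : ℝ≥0∞) by
      exact_mod_cast hyi)
  rw [WeightedGraph.wdist_comm] at h3
  have h2 : (construction G pivot ω).wdist s t ≤
      ((((m - m / 2) * d + (d + (m / 2) * d) : ℕ) : ℕ∞) : ℝ≥0∞) := by
    refine (wdist_le_edist G pivot ω hst).trans ?_
    have : G.edist s t ≤ (((m - m / 2) * d + (d + (m / 2) * d) : ℕ) : ℕ∞) := by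
      simp only [Nat.cast_add]
      refine G.edist_triangle.trans (add_le_add ?_ (G.edist_triangle.trans (add_le_add hd ?_)))
      · exact G.edist_comm.trans_le (hsd.trans_le hxi)
      · exact htd.trans_le hyi
    exact_mod_cast this
  refine (WeightedGraph.wdist_triangle _ x s y).trans ((add_le_add h1
    ((WeightedGraph.wdist_triangle _ s t y).trans (add_le_add h2 h3))).trans ?_)
  have hm : m - m / 2 + m / 2 = m := by omega
  have : (m - m / 2) * d + ((m - m / 2) * d + (d + (m / 2) * d) + (m / 2) * d) = (K - 2) * d := by
    rw [show K - 2 = 2 * m + 1 by omega]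
    nlinarith
  exact_mod_cast this.le

lemma wdist_le_one_of_adj {u v : V} (h : G.Adj u v)
    (hE : (u, v) ∈ nearEdges G ω) : (construction G pivot ω).wdist u v ≤ 1 := by
  refine (wdist_le_edist G pivot ω (nearEdges_subset G pivot ω hE)).trans ?_
  rw [SimpleGraph.edist_eq_one_iff_adj.2 h]; simp

/-- Along a walk, either all edges are near edges, or the walk may be cut at the last edge that is
not, whose endpoint is within distance one of the first level. -/
lemma exists_last_far_vertex {u v : V} (p : G.Walk u v) :
    (construction G pivot ω).wdist u v ≤ (p.length : ℝ≥0∞) ∨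
      ∃ y, ∃ b c : ℕ, G.edist u y ≤ b ∧ b + c = p.length ∧
        (construction G pivot ω).wdist y v ≤ c ∧ setDist G y (level ω 1) ≤ 1 := by
  induction p with
  | nil => left; simp [WeightedGraph.wdist_self]
  | @cons a b c h p ih =>
    rcases ih with h1 | ⟨y, b', c', h1, h2, h3, h4⟩
    · by_cases hE : (a, b) ∈ nearEdges G ω
      · left
        refine (WeightedGraph.wdist_triangle _ a b c).trans
          ((add_le_add (wdist_le_one_of_adj G ω h hE) h1).trans ?_)
        rw [SimpleGraph.Walk.length_cons, Nat.cast_add, Nat.cast_one, add_comm]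
      · right
        refine ⟨b, 1, p.length, ?_, ?_, h1, ?_⟩
        · rw [SimpleGraph.edist_eq_one_iff_adj.2 h]; simp
        · rw [SimpleGraph.Walk.length_cons, add_comm]
        · by_contra hc
          exact hE ⟨h, Or.inr (not_le.1 hc)⟩
    · right
      refine ⟨y, b' + 1, c', ?_, ?_, h3, h4⟩
      · refine G.edist_triangle.trans ((add_le_add
          (SimpleGraph.edist_eq_one_iff_adj.2 h).le h1).trans ?_)
        rw [Nat.cast_add, Nat.cast_one, add_comm]
      · rw [SimpleGraph.Walk.length_cons]; omega

/-- Near edges are peeled off the front. At the first edge outside `E_1` its tail serves as `x`, and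
the last such edge of the remaining walk supplies `y`. -/
lemma exists_far_vertices {u v : V} (p : G.Walk u v) :
    (construction G pivot ω).wdist u v ≤ (p.length : ℝ≥0∞) ∨
      ∃ x y, ∃ a b c : ℕ, (construction G pivot ω).wdist u x ≤ a ∧ G.edist x y ≤ b ∧
        (construction G pivot ω).wdist y v ≤ c ∧ a + b + c = p.length ∧
        setDist G x (level ω 1) ≤ 1 ∧ setDist G y (level ω 1) ≤ 1 := by
  induction p with
  | nil => left; simp [WeightedGraph.wdist_self]
  | @cons a b c h p ih =>
    by_cases hE : (a, b) ∈ nearEdges G ω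
    · have hab := wdist_le_one_of_adj (pivot := pivot) G ω h hE
      rcases ih with h1 | ⟨x, y, a', b', c', h1, h2, h3, h4, h5⟩
      · left
        refine (WeightedGraph.wdist_triangle _ a b c).trans ((add_le_add hab h1).trans ?_)
        rw [SimpleGraph.Walk.length_cons, Nat.cast_add, Nat.cast_one, add_comm]
      · right
        refine ⟨x, y, a' + 1, b', c', ?_, h2, h3, ?_, h5⟩
        · refine (WeightedGraph.wdist_triangle _ a b x).trans ((add_le_add hab h1).trans ?_)
          rw [Nat.cast_add, Nat.cast_one, add_comm]
        · rw [SimpleGraph.Walk.length_cons]; omega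
    · have ha : setDist G a (level ω 1) ≤ 1 := by
        by_contra hc
        exact hE ⟨h, Or.inl (not_le.1 hc)⟩
      rcases exists_last_far_vertex (pivot := pivot) G ω (SimpleGraph.Walk.cons h p) with
        h1 | ⟨y, b', c', h1, h2, h3, h4⟩
      · exact Or.inl h1
      · exact Or.inr ⟨a, y, 0, b', c', by simp [WeightedGraph.wdist_self], h1, h3, by omega, ha, h4⟩

lemma wdist_le_of_walk (hp : IsPivotRule G pivot) {m : ℕ} (hK : K = 2 * m + 3) {u v : V}
    (p : G.Walk u v) :
    (construction G pivot ω).wdist u v ≤ (((K - 2) * p.length + (2 * K - 2) : ℕ) : ℝ≥0∞) := by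
  rcases exists_far_vertices (pivot := pivot) G ω p with
    h | ⟨x, y, a, b, c, hux, hxy, hyv, hsum, hx, hy⟩
  · refine h.trans ?_
    have : p.length ≤ (K - 2) * p.length + (2 * K - 2) := by
      rw [show K - 2 = 2 * m + 1 by omega]; nlinarith
    exact_mod_cast this
  have hx' : setDist G x (level ω 1) ≤ ((1 : ℕ) : ℕ∞) := by simpa using hx
  have hy' : setDist G y (level ω 1) ≤ ((1 : ℕ) : ℕ∞) := by simpa using hy
  have hne := level_nonempty_of_setDist_le G ω hx'
  set s := pivot (level ω 1) x with hs
  set t := pivot (level ω 1) y with ht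
  obtain ⟨hsi, hsd⟩ := hp (level ω 1) x hne
  obtain ⟨hti, htd⟩ := hp (level ω 1) y hne
  have h1 : (construction G pivot ω).wdist x s ≤ 1 :=
    (hp.wdist_pivot_le G ω le_rfl (by omega) hne x).trans (by exact_mod_cast hx)
  have h2 : (construction G pivot ω).wdist t y ≤ 1 := by
    rw [WeightedGraph.wdist_comm]
    exact (hp.wdist_pivot_le G ω le_rfl (by omega) hne y).trans (by exact_mod_cast hy)
  have hst : G.edist s t ≤ ((1 + (b + 1) : ℕ) : ℕ∞) := by
    push_cast
    refine G.edist_triangle.trans (add_le_add ?_ (G.edist_triangle.trans (add_le_add hxy ?_)))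
    · exact G.edist_comm.trans_le (hsd.trans_le hx)
    · exact htd.trans_le hy
  have h3 := wdist_le_of_mem_level_one G ω hp hK hsi hti hst
  -- The detours through `s` and `t` replace `b` by `b + 2` and add 2, whence the additive term `2(K
  -- - 2) + 2`.
  have hbound : a + (1 + ((K - 2) * (1 + (b + 1)) + (1 + c))) ≤
      (K - 2) * p.length + (2 * K - 2) := by
    rw [← hsum, show K - 2 = 2 * m + 1 by omega, show 2 * K - 2 = 4 * m + 4 by omega]
    nlinarith
  calc (construction G pivot ω).wdist u v
      ≤ (a : ℝ≥0∞) + (1 + ((((K - 2) * (1 + (b + 1)) : ℕ) : ℝ≥0∞) + (1 + (c : ℝ≥0∞)))) := by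
        refine (WeightedGraph.wdist_triangle _ u x v).trans (add_le_add hux ?_)
        refine (WeightedGraph.wdist_triangle _ x s v).trans (add_le_add h1 ?_)
        refine (WeightedGraph.wdist_triangle _ s t v).trans (add_le_add h3 ?_)
        exact (WeightedGraph.wdist_triangle _ t y v).trans (add_le_add h2 hyv)
    _ ≤ _ := by exact_mod_cast hbound

lemma wdist_construction_le (hp : IsPivotRule G pivot) {m : ℕ} (hK : K = 2 * m + 3) {u v : V}
    (h : G.Reachable u v) :
    (construction G pivot ω).wdist u v ≤
      (((K - 2) * G.dist u v + (2 * K - 2) : ℕ) : ℝ≥0∞) := by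
  obtain ⟨p, hpl⟩ := h.exists_walk_length_eq_dist
  rw [← hpl]
  exact wdist_le_of_walk G ω hp hK p

lemma isEmulator_construction (hp : IsPivotRule G pivot) {m : ℕ} (hK : K = 2 * m + 3) :
    IsEmulator G ((K - 2 : ℕ) : ℝ≥0) ((2 * K - 2 : ℕ) : ℝ≥0) (construction G pivot ω) := by
  refine fun u v => ⟨edist_le_wdist G pivot ω u v, ?_⟩
  by_cases h : G.Reachable u v
  · refine (wdist_construction_le G ω hp hK h).trans ?_
    rw [coe_edist_eq_coe_dist G h]
    push_cast
    exact le_rfl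
  -- The factor must be nonzero, since `0 * ⊤ = 0` in `ℝ≥0∞`.
  · have hK' : ((K - 2 : ℕ) : ℝ≥0∞) ≠ 0 := by
      rw [Nat.cast_ne_zero]; omega
    rw [SimpleGraph.edist_eq_top_of_not_reachable h]
    rw [ENat.toENNReal_top, ENNReal.coe_natCast, ENNReal.mul_top hK', top_add]
    exact le_top

end

end Stretch

/-! ### Probabilities in the hierarchy and the expected size. -/

section Size

variable {V : Type*} [Fintype V]

instance isProbabilityMeasure_coinMeasure (K : ℕ) : IsProbabilityMeasure (coinMeasure V K) := by
  unfold coinMeasure; infer_instance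

lemma prod_ite_lt_eq_pow (N a : ℕ) (ha : a ≤ N) (q : ℝ) :
    ∏ j : Fin N, (if (j : ℕ) < a then q else 1) = q ^ a := by
  rw [Fin.prod_univ_eq_prod_range (fun j => if j < a then q else 1) N, Finset.prod_ite,
    Finset.prod_const, Finset.prod_const_one, mul_one]
  congr 1
  rw [show (Finset.range N).filter (fun x => x < a) = Finset.range a by ext; simp; omega,
    Finset.card_range]

/-- The event is a box in the product space: `v` constrains exactly its first `a v` coins. -/
lemma measureReal_forall_mem_level {K : ℕ} (hK : 0 < K) (a : V → ℕ) (ha : ∀ v, a v ≤ K - 1) :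
    (coinMeasure V K).real {ω | ∀ v, v ∈ level ω (a v)} =
      ∏ v, (sampleProb (Fintype.card V) K : ℝ) ^ a v := by
  classical
  have hset : {ω : Coins V K | ∀ v, v ∈ level ω (a v)} =
      Set.univ.pi fun x : Fin (K - 1) × V => if (x.1 : ℕ) < a x.2 then {true} else Set.univ := by
    ext ω
    simp only [level, Set.mem_ofPred_eq, Set.mem_univ_pi, Prod.forall]
    constructor
    · intro h j v
      split_ifs with hj
      · exact (h v).2 j hj
      · trivial
    · refine fun h v => ⟨by have := ha v; omega, fun j hj => ?_⟩
      have := h j v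
      rw [if_pos hj] at this
      exact this
  rw [hset, coinMeasure, measureReal_def, Measure.pi_pi, ENNReal.toReal_prod,
    Fintype.prod_prod_type_right]
  refine Finset.prod_congr rfl fun v _ => ?_
  rw [← prod_ite_lt_eq_pow (K - 1) (a v) (ha v)]
  refine Finset.prod_congr rfl fun j _ => ?_
  rw [← measureReal_def]
  split_ifs
  · exact bernoulliMeasure_real_apply_of_mem_of_notMem _ (measurableSet_singleton _) (by simp)
      (by simp)
  · simp

/-- Inclusion-exclusion, one vertex of `T` at a time: `t` is so far unconstrained, so requiring it
in level `c` costs a factor `p^c`, and subtracting that event leaves `1 - p^c`. -/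
lemma measureReal_forall_mem_level_and_forall_notMem {K : ℕ} (hK : 0 < K) {c : ℕ}
    (hc : c ≤ K - 1) (T : Finset V) (a : V → ℕ) (ha : ∀ v, a v ≤ K - 1)
    (hT : ∀ t ∈ T, a t = 0) :
    (coinMeasure V K).real {ω | (∀ v, v ∈ level ω (a v)) ∧ ∀ t ∈ T, t ∉ level ω c} =
      (∏ v, (sampleProb (Fintype.card V) K : ℝ) ^ a v) *
        (1 - (sampleProb (Fintype.card V) K : ℝ) ^ c) ^ T.card := by
  classical
  induction T using Finset.induction_on generalizing a with
  | empty => simpa using measureReal_forall_mem_level hK a ha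
  | insert t T ht ih =>
    set p : ℝ := (sampleProb (Fintype.card V) K : ℝ) with hp
    have hat : a t = 0 := hT t (Finset.mem_insert_self _ _)
    have h1 := ih a ha fun s hs => hT s (Finset.mem_insert_of_mem hs)
    have h2 := ih (Function.update a t c)
      (fun v => by
        rcases eq_or_ne v t with rfl | hv
        · simpa using hc
        · simpa [hv] using ha v)
      (fun s hs => by
        rw [Function.update_of_ne (by rintro rfl; exact ht hs)]
        exact hT s (Finset.mem_insert_of_mem hs))
    have hprod : ∏ v, p ^ Function.update a t c v = p ^ c * ∏ v, p ^ a v := by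
      rw [← Finset.mul_prod_erase _ _ (Finset.mem_univ t),
        ← Finset.mul_prod_erase _ (fun v => p ^ a v) (Finset.mem_univ t), hat,
        Function.update_self, pow_zero, one_mul]
      congr 1
      refine Finset.prod_congr rfl fun v hv => ?_
      rw [Function.update_of_ne (Finset.ne_of_mem_erase hv)]
    have hdiff : {ω : Coins V K | (∀ v, v ∈ level ω (a v)) ∧ ∀ s ∈ insert t T, s ∉ level ω c} =
        {ω | (∀ v, v ∈ level ω (a v)) ∧ ∀ s ∈ T, s ∉ level ω c} \
          {ω | (∀ v, v ∈ level ω (Function.update a t c v)) ∧ ∀ s ∈ T, s ∉ level ω c} := by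
      ext ω
      simp only [Set.mem_ofPred_eq, Set.mem_sdiff, Finset.forall_mem_insert, not_and]
      constructor
      · rintro ⟨h, h3, h4⟩
        exact ⟨⟨h, h4⟩, fun h5 => absurd (by simpa using h5 t) h3⟩
      · rintro ⟨⟨h, h4⟩, h5⟩
        refine ⟨h, fun h6 => h5 (fun v => ?_) h4, h4⟩
        rcases eq_or_ne v t with rfl | hv
        · simpa using h6
        · simpa [hv] using h v
    have hsub : {ω : Coins V K | (∀ v, v ∈ level ω (Function.update a t c v)) ∧
        ∀ s ∈ T, s ∉ level ω c} ⊆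
          {ω | (∀ v, v ∈ level ω (a v)) ∧ ∀ s ∈ T, s ∉ level ω c} := by
      rintro ω ⟨h, h4⟩
      refine ⟨fun v => ?_, h4⟩
      rcases eq_or_ne v t with rfl | hv
      · rw [hat, level_zero hK]; trivial
      · simpa [hv] using h v
    rw [hdiff, measureReal_sdiff hsub (Set.toFinite _).measurableSet, h1, h2, hprod,
      Finset.card_insert_of_notMem ht]
    ring

/-- Vertices in `T` avoid level `c`, while `x ≠ y` lie in prescribed levels. -/
lemma measureReal_mem_mem_notMem {K : ℕ} (hK : 0 < K) {a b c : ℕ} (ha : a ≤ K - 1)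
    (hb : b ≤ K - 1) (hc : c ≤ K - 1) {x y : V} (hxy : x ≠ y) (T : Finset V) (hx : x ∉ T)
    (hy : y ∉ T) :
    (coinMeasure V K).real {ω | x ∈ level ω a ∧ y ∈ level ω b ∧ ∀ t ∈ T, t ∉ level ω c} =
      (sampleProb (Fintype.card V) K : ℝ) ^ (a + b) *
        (1 - (sampleProb (Fintype.card V) K : ℝ) ^ c) ^ T.card := by
  classical
  set f : V → ℕ := fun v => if v = x then a else if v = y then b else 0 with hf
  have hset : {ω : Coins V K | x ∈ level ω a ∧ y ∈ level ω b ∧ ∀ t ∈ T, t ∉ level ω c} =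
      {ω | (∀ v, v ∈ level ω (f v)) ∧ ∀ t ∈ T, t ∉ level ω c} := by
    ext ω
    simp only [Set.mem_ofPred_eq, ← and_assoc]
    refine and_congr_left fun _ => ⟨fun h v => ?_, fun h => ⟨?_, ?_⟩⟩
    · simp only [hf]
      split_ifs with h1 h2
      · exact h1 ▸ h.1
      · exact h2 ▸ h.2
      · rw [level_zero hK]; trivial
    · simpa [hf] using h x
    · simpa [hf, hxy.symm] using h y
  rw [hset, measureReal_forall_mem_level_and_forall_notMem hK hc T f]
  · congr 1
    rw [← Finset.mul_prod_erase _ _ (Finset.mem_univ x),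
      ← Finset.mul_prod_erase _ _ (Finset.mem_erase.2 ⟨hxy.symm, Finset.mem_univ y⟩),
      Finset.prod_eq_one, mul_one, pow_add]
    · simp [hf, hxy.symm]
    · intro v hv
      simp only [Finset.mem_erase, Finset.mem_univ, and_true] at hv
      simp [hf, hv.1, hv.2]
  · intro v
    simp only [hf]
    split_ifs <;> omega
  · intro t ht
    simp only [hf]
    rw [if_neg (by rintro rfl; exact hx ht), if_neg (by rintro rfl; exact hy ht)]

/-- An element of maximal `f` sees all the others, giving the top power; restoring it can only raise
the other exponents. Ties are harmless, as they only increase the counts. -/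
lemma sum_pow_card_le_le_geom_sum {α β : Type*} [DecidableEq α] [LinearOrder β] (f : α → β)
    {x : ℝ} (hx0 : 0 ≤ x) (hx1 : x ≤ 1) (W : Finset α) :
    ∑ s ∈ W, x ^ ((W.erase s).filter fun t => f t ≤ f s).card ≤ ∑ i ∈ Finset.range W.card, x ^ i := by
  induction W using Finset.induction_on_max_value f with
  | empty => simp
  | insert a W ha hmax ih =>
    rw [Finset.sum_insert ha, Finset.card_insert_of_notMem ha, Finset.sum_range_succ, add_comm]
    refine add_le_add (le_trans (Finset.sum_le_sum fun s _ => ?_) ih) (le_of_eq ?_)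
    · exact pow_le_pow_of_le_one hx0 hx1 (Finset.card_le_card
        (Finset.filter_subset_filter _ (Finset.erase_subset_erase _ (Finset.subset_insert _ _))))
    · rw [Finset.erase_insert ha, Finset.filter_true_of_mem hmax]

lemma mul_geom_sum_one_sub_le {q : ℝ} (hq1 : q ≤ 1) (m : ℕ) :
    q * ∑ i ∈ Finset.range m, (1 - q) ^ i ≤ 1 := by
  have h := mul_neg_geom_sum (1 - q) m
  rw [sub_sub_cancel] at h
  rw [h]
  linarith [pow_nonneg (sub_nonneg.2 hq1) m]

/-- Each of the `m` terms of the geometric sum is at least `(1 - q)^m`. -/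
lemma mul_mul_pow_one_sub_le {q : ℝ} (hq0 : 0 ≤ q) (hq1 : q ≤ 1) (m : ℕ) :
    q * (m * (1 - q) ^ m) ≤ 1 := by
  refine (mul_le_mul_of_nonneg_left ?_ hq0).trans (mul_geom_sum_one_sub_le hq1 m)
  have h := Finset.card_nsmul_le_sum (Finset.range m) (fun i => (1 - q) ^ i) ((1 - q) ^ m)
    fun i hi => pow_le_pow_of_le_one (by linarith) (by linarith) (Finset.mem_range.1 hi).le
  rwa [Finset.card_range, nsmul_eq_mul] at h

variable (G : SimpleGraph V)

/-- The expected number of ordered pairs of distinct vertices in a random set of pairs. -/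
noncomputable def expectedPairs {K : ℕ} (X : Coins V K → Set (V × V)) : ℝ :=
  ∑ u, ∑ v, (coinMeasure V K).real {ω | u ≠ v ∧ (u, v) ∈ X ω}

lemma expectedPairs_mono {K : ℕ} {X Y : Coins V K → Set (V × V)} (h : ∀ ω, X ω ⊆ Y ω) :
    expectedPairs X ≤ expectedPairs Y :=
  Finset.sum_le_sum fun _ _ => Finset.sum_le_sum fun _ _ =>
    measureReal_mono fun ω hω => ⟨hω.1, h ω hω.2⟩

lemma expectedPairs_union_le {K : ℕ} (X Y : Coins V K → Set (V × V)) :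
    expectedPairs (fun ω => X ω ∪ Y ω) ≤ expectedPairs X + expectedPairs Y := by
  simp only [expectedPairs, ← Finset.sum_add_distrib]
  refine Finset.sum_le_sum fun u _ => Finset.sum_le_sum fun v _ => ?_
  refine le_trans (measureReal_mono ?_) (measureReal_union_le _ _)
  rintro ω ⟨h, h1 | h1⟩
  exacts [Or.inl ⟨h, h1⟩, Or.inr ⟨h, h1⟩]

lemma expectedPairs_biUnion_le {K : ℕ} {ι : Type*} (I : Finset ι)
    (X : ι → Coins V K → Set (V × V)) :
    expectedPairs (fun ω => ⋃ i ∈ I, X i ω) ≤ ∑ i ∈ I, expectedPairs (X i) := by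
  simp only [expectedPairs]
  rw [Finset.sum_comm (s := I)]
  refine Finset.sum_le_sum fun u _ => ?_
  rw [Finset.sum_comm (s := I)]
  refine Finset.sum_le_sum fun v _ => ?_
  refine le_trans (measureReal_mono ?_ (measure_ne_top _ _)) (measureReal_biUnion_finset_le _ _)
  rintro ω ⟨h, h1⟩
  simp only [Set.mem_iUnion] at h1 ⊢
  obtain ⟨i, hi, h1⟩ := h1
  exact ⟨i, hi, h, h1⟩

/-- Every edge has an orientation in `F`, so counting ordered pairs loses at most a factor 2 and
needs no symmetrisation. -/
lemma expectedSize_le_expectedPairs (pivot : Set V → V → V) (K : ℕ) :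
    expectedSize G pivot K ≤ expectedPairs (emulatorPairs G pivot (K := K)) := by
  classical
  have hpt : ∀ ω : Coins V K, ((construction G pivot ω).size : ℝ) ≤
      ∑ u, ∑ v, Set.indicator {ω | u ≠ v ∧ (u, v) ∈ emulatorPairs G pivot ω} 1 ω := by
    intro ω
    set P := Finset.univ.filter fun e : V × V => e.1 ≠ e.2 ∧ e ∈ emulatorPairs G pivot ω with hP
    have hsub : (construction G pivot ω).graph.edgeSet ⊆
        ((P.image fun e => s(e.1, e.2) : Finset (Sym2 V)) : Set (Sym2 V)) := by
      intro e
      induction e using Sym2.ind with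
      | _ u v =>
        rintro ⟨hne, -, h | h⟩
        · exact Finset.mem_coe.2 (Finset.mem_image.2 ⟨(u, v), by simp [hP, hne, h], rfl⟩)
        · exact Finset.mem_coe.2 (Finset.mem_image.2
            ⟨(v, u), by simp [hP, hne.symm, h], Sym2.eq_swap⟩)
    have hcard : (construction G pivot ω).size ≤ P.card :=
      (Set.ncard_le_ncard hsub (Finset.finite_toSet _)).trans
        ((Set.ncard_coe_finset _).trans_le Finset.card_image_le)
    refine (Nat.cast_le.2 hcard).trans (le_of_eq ?_)
    rw [← Fintype.sum_prod_type' (f := fun u v =>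
      Set.indicator {ω | u ≠ v ∧ (u, v) ∈ emulatorPairs G pivot ω} (1 : Coins V K → ℝ) ω), hP,
      Finset.card_filter]
    push_cast
    refine Finset.sum_congr rfl fun e _ => ?_
    simp [Set.indicator_apply]
  refine (integral_mono Integrable.of_finite Integrable.of_finite hpt).trans (le_of_eq ?_)
  rw [integral_finsetSum _ fun _ _ => Integrable.of_finite]
  refine Finset.sum_congr rfl fun u _ => ?_
  rw [integral_finsetSum _ fun _ _ => Integrable.of_finite]
  exact Finset.sum_congr rfl fun v _ => integral_indicator_one (Set.toFinite _).measurableSet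

/-- For fixed `u` and `i` the events indexed by `v` are the disjoint fibres of the pivot map, with
total mass at most 1. -/
lemma expectedPairs_pivotPairs_le (pivot : Set V → V → V) (K : ℕ) :
    expectedPairs (pivotPairs pivot (K := K)) ≤ K * Fintype.card V := by
  classical
  have h1 : expectedPairs (pivotPairs pivot (K := K)) ≤
      expectedPairs fun ω : Coins V K => ⋃ i ∈ Finset.Icc 1 (K - 1),
        {e | e.2 = pivot (level ω i) e.1} := by
    refine expectedPairs_mono fun ω e => ?_
    rintro ⟨i, hi, -, he⟩
    exact Set.mem_biUnion hi he
  refine h1.trans ((expectedPairs_biUnion_le _ _).trans ?_)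
  have h2 : ∀ i ∈ Finset.Icc 1 (K - 1), expectedPairs (fun ω : Coins V K =>
      {e : V × V | e.2 = pivot (level ω i) e.1}) ≤ Fintype.card V := by
    intro i _
    rw [← Finset.card_univ, ← nsmul_one]
    refine Finset.sum_le_card_nsmul _ _ _ fun u _ => ?_
    refine (Finset.sum_le_sum (g := fun v => (coinMeasure V K).real
      ((fun ω => pivot (level ω i) u) ⁻¹' {v})) fun v _ => measureReal_mono ?_).trans ?_
    · rintro ω ⟨-, h⟩
      exact h.symm
    · rw [sum_measureReal_preimage_singleton _ fun _ _ => (Set.toFinite _).measurableSet]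
      exact measureReal_le_one
  refine (Finset.sum_le_card_nsmul _ _ _ h2).trans ?_
  rw [nsmul_eq_mul, Nat.card_Icc]
  gcongr
  omega

lemma sampleProb_pow_mem (n K i : ℕ) :
    0 ≤ (sampleProb n K : ℝ) ^ i ∧ (sampleProb n K : ℝ) ^ i ≤ 1 :=
  ⟨pow_nonneg (sampleProb n K).2.1 i, pow_le_one₀ (sampleProb n K).2.1 (sampleProb n K).2.2⟩

lemma measureReal_forall_notMem_level {K : ℕ} (hK : 0 < K) {c : ℕ} (hc : c ≤ K - 1)
    (T : Finset V) :
    (coinMeasure V K).real {ω | ∀ t ∈ T, t ∉ level ω c} =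
      (1 - (sampleProb (Fintype.card V) K : ℝ) ^ c) ^ T.card := by
  have h := measureReal_forall_mem_level_and_forall_notMem hK hc T (fun _ => 0) (by simp) (by simp)
  simpa [level_zero hK] using h

/-- If `1 < δ(u, S_1)`, all neighbours of `u` miss `S_1`. Summing over them gives `deg(u)(1 -
p)^deg(u) ≤ 1/p`; the factor 2 accounts for the two endpoints. Here `q` stands for `1/p`. -/
lemma expectedPairs_nearEdges_le {K : ℕ} (hK : 2 ≤ K) {q : ℝ}
    (hq : 1 ≤ q * (sampleProb (Fintype.card V) K : ℝ)) (hq0 : 0 ≤ q) :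
    expectedPairs (nearEdges G (K := K)) ≤ 2 * (q * Fintype.card V) := by
  classical
  set p : ℝ := (sampleProb (Fintype.card V) K : ℝ) with hp
  have hp0 : 0 ≤ p := (sampleProb (Fintype.card V) K).2.1
  have hp1 : p ≤ 1 := (sampleProb (Fintype.card V) K).2.2
  have hone : ∀ u v : V, (coinMeasure V K).real
      {ω | G.Adj u v ∧ 1 < setDist G u (level ω 1)} ≤
        if G.Adj u v then (1 - p) ^ G.degree u else 0 := by
    intro u v
    split_ifs with h
    · have := measureReal_forall_notMem_level (V := V) (show 0 < K by omega)
        (show 1 ≤ K - 1 by omega) (G.neighborFinset u)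
      rw [pow_one, SimpleGraph.card_neighborFinset_eq_degree] at this
      rw [← this]
      refine measureReal_mono ?_
      rintro ω ⟨-, h1⟩ t ht htl
      have h2 := setDist_le_edist G (u := u) htl
      rw [SimpleGraph.edist_eq_one_iff_adj.2 (by simpa using ht)] at h2
      exact absurd h1 (not_lt.2 h2)
    · simp [h]
  have hsum : ∑ u : V, ∑ v : V, (if G.Adj u v then (1 - p) ^ G.degree u else 0) ≤
      q * Fintype.card V := by
    rw [mul_comm, ← Finset.card_univ, ← nsmul_eq_mul]
    refine Finset.sum_le_card_nsmul _ _ _ fun u _ => ?_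
    rw [← Finset.sum_filter, Finset.sum_const, ← SimpleGraph.neighborFinset_eq_filter,
      SimpleGraph.card_neighborFinset_eq_degree, nsmul_eq_mul]
    have h1 := mul_mul_pow_one_sub_le hp0 hp1 (G.degree u)
    have h2 : 0 ≤ (G.degree u : ℝ) * (1 - p) ^ G.degree u :=
      mul_nonneg (by positivity) (pow_nonneg (by linarith) _)
    calc (G.degree u : ℝ) * (1 - p) ^ G.degree u
        ≤ (q * p) * ((G.degree u : ℝ) * (1 - p) ^ G.degree u) := le_mul_of_one_le_left h2 hq
      _ = q * (p * ((G.degree u : ℝ) * (1 - p) ^ G.degree u)) := by ring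
      _ ≤ q * 1 := mul_le_mul_of_nonneg_left h1 hq0
      _ = q := mul_one q
  calc expectedPairs (nearEdges G (K := K))
      ≤ ∑ u : V, ∑ v : V, ((if G.Adj u v then (1 - p) ^ G.degree u else 0) +
          (if G.Adj v u then (1 - p) ^ G.degree v else 0)) := by
        refine Finset.sum_le_sum fun u _ => Finset.sum_le_sum fun v _ => ?_
        refine le_trans (measureReal_mono ?_) ((measureReal_union_le _ _).trans
          (add_le_add (hone u v) (hone v u)))
        rintro ω ⟨-, h, h1 | h1⟩
        exacts [Or.inl ⟨h, h1⟩, Or.inr ⟨h.symm, h1⟩]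
    _ ≤ 2 * (q * Fintype.card V) := by
        simp only [Finset.sum_add_distrib]
        rw [Finset.sum_comm (f := fun u v => if G.Adj v u then (1 - p) ^ G.degree v else 0)]
        linarith

/-- If `s` is in the ball, every vertex at least as near to `u` misses `S_{i+j}`, so summing over
`s` gives at most `1/p^(i+j)`. The memberships `u ∈ S_{j-1}` and `s ∈ S_i` contribute `p^(j-1+i)`,
leaving `1/p`: this is why `B_2` is restricted to `S_1`. -/
lemma expectedPairs_bunch_le {K i j : ℕ} (hj : 1 ≤ j) (hij : i + j ≤ K - 1) {q : ℝ}
    (hq : 1 ≤ q * (sampleProb (Fintype.card V) K : ℝ)) (hq0 : 0 ≤ q) :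
    expectedPairs (fun ω : Coins V K => {e | e.1 ∈ level ω (j - 1) ∧
      e.2 ∈ ball G e.1 (level ω i) (level ω (i + j))}) ≤ q * Fintype.card V := by
  classical
  set p : ℝ := (sampleProb (Fintype.card V) K : ℝ) with hp
  have hp0 : 0 ≤ p := (sampleProb (Fintype.card V) K).2.1
  obtain ⟨hr0, hr1⟩ := sampleProb_pow_mem (Fintype.card V) K (i + j)
  obtain ⟨hs0, -⟩ := sampleProb_pow_mem (Fintype.card V) K (j - 1 + i)
  rw [← hp] at hr0 hr1 hs0
  rw [mul_comm, ← Finset.card_univ, ← nsmul_eq_mul]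
  refine Finset.sum_le_card_nsmul _ _ _ fun u _ => ?_
  set W := Finset.univ.erase u with hW
  -- Both `u` and `s` are excluded, so that avoidance is independent of their own levels.
  set T : V → Finset V := fun s => (W.erase s).filter fun t => G.edist u t ≤ G.edist u s with hT
  have hone : ∀ s ∈ W, (coinMeasure V K).real {ω | u ≠ s ∧ (u, s) ∈ {e : V × V |
      e.1 ∈ level ω (j - 1) ∧ e.2 ∈ ball G e.1 (level ω i) (level ω (i + j))}} ≤
        p ^ (j - 1 + i) * (1 - p ^ (i + j)) ^ (T s).card := by
    intro s hs
    rw [hp, ← measureReal_mem_mem_notMem (V := V) (show 0 < K by omega)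
      (show j - 1 ≤ K - 1 by omega) (show i ≤ K - 1 by omega) hij
      (Finset.ne_of_mem_erase hs).symm (T s) (by simp [hT, hW]) (by simp [hT])]
    refine measureReal_mono ?_
    rintro ω ⟨-, h1, h2, h3⟩
    refine ⟨h1, h2, fun t ht htl => ?_⟩
    exact absurd (h3.trans_le (setDist_le_edist G htl)) (not_lt.2 (Finset.mem_filter.1 ht).2)
  have hself : (coinMeasure V K).real {ω | u ≠ u ∧ (u, u) ∈ {e : V × V |
      e.1 ∈ level ω (j - 1) ∧ e.2 ∈ ball G e.1 (level ω i) (level ω (i + j))}} = 0 := by simp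
  rw [← Finset.add_sum_erase _ _ (Finset.mem_univ u), hself, zero_add]
  refine (Finset.sum_le_sum hone).trans ?_
  rw [← Finset.mul_sum]
  set S := ∑ s ∈ W, (1 - p ^ (i + j)) ^ (T s).card with hS
  have hS0 : 0 ≤ S := Finset.sum_nonneg fun s _ => pow_nonneg (by linarith) _
  have hS1 : p ^ (i + j) * S ≤ 1 :=
    (mul_le_mul_of_nonneg_left (sum_pow_card_le_le_geom_sum (G.edist u) (by linarith)
      (by linarith) W) hr0).trans (mul_geom_sum_one_sub_le hr1 _)
  have hpow : p ^ (i + j) = p * p ^ (j - 1 + i) := by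
    rw [← pow_succ']; congr 1; omega
  calc p ^ (j - 1 + i) * S ≤ (q * p) * (p ^ (j - 1 + i) * S) :=
        le_mul_of_one_le_left (mul_nonneg hs0 hS0) hq
    _ = q * (p ^ (i + j) * S) := by rw [hpow]; ring
    _ ≤ q * 1 := mul_le_mul_of_nonneg_left hS1 hq0
    _ = q := mul_one q

lemma expectedPairs_bunchPairs_le {K j : ℕ} (hj : 1 ≤ j) {q : ℝ}
    (hq : 1 ≤ q * (sampleProb (Fintype.card V) K : ℝ)) (hq0 : 0 ≤ q) :
    expectedPairs (fun ω : Coins V K => bunchPairs G ω j (level ω (j - 1))) ≤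
      K * (q * Fintype.card V) := by
  have h1 : expectedPairs (fun ω : Coins V K => bunchPairs G ω j (level ω (j - 1))) ≤
      expectedPairs fun ω : Coins V K => ⋃ i ∈ (Finset.range K).filter fun i => i + j ≤ K - 1,
        {e | e.1 ∈ level ω (j - 1) ∧ e.2 ∈ ball G e.1 (level ω i) (level ω (i + j))} := by
    refine expectedPairs_mono fun ω e => ?_
    rintro ⟨h, i, hi, he⟩
    exact Set.mem_biUnion (x := i) (by simp; omega) ⟨h, he⟩
  refine h1.trans ((expectedPairs_biUnion_le _ _).trans ?_)
  refine (Finset.sum_le_card_nsmul _ _ _ fun i hi =>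
    expectedPairs_bunch_le G hj (Finset.mem_filter.1 hi).2 hq hq0).trans ?_
  rw [nsmul_eq_mul]
  gcongr
  exact (Finset.card_filter_le _ _).trans_eq (Finset.card_range K)

lemma expectedPairs_productPairs_le (K : ℕ) :
    expectedPairs (productPairs (V := V) (K := K)) ≤
      K * ((sampleProb (Fintype.card V) K : ℝ) ^ (K - 1) * Fintype.card V ^ 2) := by
  refine (expectedPairs_biUnion_le _ _).trans ?_
  have h : ∀ i ∈ Finset.Icc 1 K, expectedPairs (fun ω : Coins V K =>
      level ω (i - 1) ×ˢ level ω (K - i)) ≤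
        (sampleProb (Fintype.card V) K : ℝ) ^ (K - 1) * Fintype.card V ^ 2 := by
    intro i hi
    obtain ⟨hi1, hiK⟩ := Finset.mem_Icc.1 hi
    rw [mul_comm, sq, mul_assoc, ← Finset.card_univ, ← nsmul_eq_mul, ← nsmul_eq_mul]
    refine Finset.sum_le_card_nsmul _ _ _ fun u _ => Finset.sum_le_card_nsmul _ _ _ fun v _ => ?_
    rcases eq_or_ne u v with rfl | huv
    · simpa using (sampleProb_pow_mem (Fintype.card V) K (K - 1)).1
    · have := measureReal_mem_mem_notMem (V := V) (show 0 < K by omega)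
        (show i - 1 ≤ K - 1 by omega) (show K - i ≤ K - 1 by omega) (Nat.zero_le _) huv ∅
        (by simp) (by simp)
      rw [show i - 1 + (K - i) = K - 1 by omega, Finset.card_empty, pow_zero, mul_one] at this
      rw [Finset.card_univ, ← this]
      refine measureReal_mono ?_
      rintro ω ⟨-, h1, h2⟩
      exact ⟨h1, h2, by simp⟩
  refine (Finset.sum_le_card_nsmul _ _ _ h).trans ?_
  rw [nsmul_eq_mul, Nat.card_Icc, Nat.add_sub_cancel]

lemma expectedSize_le (pivot : Set V → V → V) {K : ℕ} (hK : 2 ≤ K) :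
    expectedSize G pivot K ≤ (4 * K + 2) * (Fintype.card V : ℝ) ^ (1 + 1 / (K : ℝ)) := by
  rcases Nat.eq_zero_or_pos (Fintype.card V) with hn | hn
  · have := Fintype.card_eq_zero_iff.1 hn
    refine (expectedSize_le_expectedPairs G pivot K).trans ?_
    simp only [expectedPairs, Finset.univ_eq_empty, Finset.sum_empty]
    positivity
  have hn1 : (1 : ℝ) ≤ Fintype.card V := by exact_mod_cast hn
  have hn0 : (0 : ℝ) < Fintype.card V := by linarith
  have hK0 : (K : ℝ) ≠ 0 := by positivity
  set n : ℝ := (Fintype.card V : ℝ) with hndef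
  set q : ℝ := n ^ (1 / (K : ℝ)) with hqdef
  have hq1 : 1 ≤ q := Real.one_le_rpow hn1 (by positivity)
  have hq0 : 0 ≤ q := by linarith
  have hp : (sampleProb (Fintype.card V) K : ℝ) = n ^ (-(1 / (K : ℝ))) := rfl
  have hqp : 1 ≤ q * (sampleProb (Fintype.card V) K : ℝ) := by
    rw [hp, hqdef, ← Real.rpow_add hn0, add_neg_cancel, Real.rpow_zero]
  have hpow : (sampleProb (Fintype.card V) K : ℝ) ^ (K - 1) * n ^ 2 = q * n := by
    rw [hp, ← Real.rpow_natCast, ← Real.rpow_mul hn0.le, ← Real.rpow_natCast n 2,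
      ← Real.rpow_add hn0, hqdef, ← Real.rpow_add_one hn0.ne', Nat.cast_sub (by omega)]
    congr 1
    push_cast
    field_simp
    ring
  have hrhs : n ^ (1 + 1 / (K : ℝ)) = q * n := by
    rw [add_comm, Real.rpow_add_one hn0.ne']
  have hD := expectedPairs_pivotPairs_le pivot K
  have hE := expectedPairs_nearEdges_le G hK hqp hq0
  have hB1 := expectedPairs_bunchPairs_le G (K := K) le_rfl hqp hq0
  have hB2 := expectedPairs_bunchPairs_le G (K := K) one_le_two hqp hq0
  have hP := expectedPairs_productPairs_le (V := V) K
  -- As `S_0 = V`, the set `B_1(V)` is the case `j = 1` of `B_j(S_{j-1})`.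
  simp only [Nat.sub_self, level_zero (show 0 < K by omega)] at hB1
  rw [← hndef] at hD hE hB1 hB2 hP
  rw [hpow] at hP
  have hnq : K * n ≤ K * (q * n) :=
    mul_le_mul_of_nonneg_left (le_mul_of_one_le_left hn0.le hq1) (by positivity)
  have hU : expectedPairs (emulatorPairs G pivot (K := K)) ≤
      expectedPairs (pivotPairs pivot (K := K)) + expectedPairs (nearEdges G (K := K)) +
        expectedPairs (fun ω : Coins V K => bunchPairs G ω 1 Set.univ) +
        expectedPairs (fun ω : Coins V K => bunchPairs G ω 2 (level ω 1)) +
        expectedPairs (productPairs (V := V) (K := K)) := by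
    refine (expectedPairs_union_le _ _).trans (add_le_add_left ?_ _)
    refine (expectedPairs_union_le _ _).trans (add_le_add_left ?_ _)
    refine (expectedPairs_union_le _ _).trans (add_le_add_left ?_ _)
    exact expectedPairs_union_le _ _
  refine (expectedSize_le_expectedPairs G pivot K).trans (hU.trans ?_)
  rw [hrhs]
  have hB2' : expectedPairs (fun ω : Coins V K => bunchPairs G ω 2 (level ω 1)) ≤
      K * (q * n) := hB2
  linarith

end Size

end Emulator

/-! ### Specialisation to depth `2^(k+1) - 1`. -/

theorem mainTheorem3 :
    -- stretch, size, and comparison, for every fixed `k ≥ 2`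
    (∀ k : ℕ, 2 ≤ k → ∃ (C : ℝ) (c : ℕ),
      ∀ (V : Type*) [Fintype V] (G : SimpleGraph V) (pivot : Set V → V → V),
        Emulator.IsPivotRule G pivot →
        (∀ ω : Emulator.Coins V (2 ^ (k + 1) - 1),
          Emulator.IsEmulator G ((2 ^ (k + 1) - 3 : ℕ) : NNReal) ((2 ^ (k + 2) - 4 : ℕ) : NNReal)
            (Emulator.construction G pivot ω)) ∧
        Emulator.expectedSize G pivot (2 ^ (k + 1) - 1) ≤
          C * (Fintype.card V : ℝ) ^ (1 + 1 / ((2 : ℝ) ^ (k + 1) - 1)) *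
            Real.log (Fintype.card V) ^ c ∧
        (∀ u v : V, u ≠ v → G.edist u v ≤ (Emulator.threshold k : ℕ∞) →
          (∀ ω : Emulator.Coins V (2 ^ (k + 1) - 1),
            (Emulator.construction G pivot ω).wdist u v ≤
              ENNReal.ofReal (((2 : ℝ) ^ (k + 1) - 3) * G.dist u v + ((2 : ℝ) ^ (k + 2) - 4))) ∧
          ((2 : ℝ) ^ (k + 1) - 3) * G.dist u v + ((2 : ℝ) ^ (k + 2) - 4) <
            G.dist u v + ((6 : ℝ) ^ k - 1) * (G.dist u v : ℝ) ^ (1 - 1 / (k : ℝ)))) ∧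
    -- the growth of the threshold
    (fun k : ℕ => (Emulator.threshold k : ℝ)) =O[Filter.atTop] (fun k : ℕ => (3 : ℝ) ^ (k ^ 2)) ∧
    -- the location of the root of the comparison polynomial
    (∀ k : ℕ, 2 ≤ k → ∃ r : ℝ,
      r ∈ Set.Ioo (((k : ℝ) - 1) * ((6 : ℝ) ^ k - 1) / (k * ((2 : ℝ) ^ (k + 1) - 4)))
        (((6 : ℝ) ^ k - 1) / ((2 : ℝ) ^ (k + 1) - 4)) ∧
      1 < r ∧ Emulator.comparisonPoly k r = 0 ∧
      (∀ x : ℝ, 1 < x → Emulator.comparisonPoly k x = 0 → x = r) ∧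
      (∀ x ∈ Set.Ioo 1 r, Emulator.comparisonPoly k x < 0)) := by
  refine ⟨fun k hk => ?_, Emulator.threshold_isBigO,
    fun k hk => Emulator.exists_root_comparisonPoly hk⟩
  have h8 : 8 ≤ 2 ^ (k + 1) := Nat.pow_le_pow_right two_pos (show 3 ≤ k + 1 by omega)
  have hdbl : 2 ^ (k + 2) = 2 * 2 ^ (k + 1) := pow_succ' _ _
  have hdblR : (2 : ℝ) ^ (k + 2) = 2 * 2 ^ (k + 1) := pow_succ' _ _
  have hK : 2 ^ (k + 1) - 1 = 2 * (2 ^ k - 2) + 3 := by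
    have : 2 ^ (k + 1) = 2 * 2 ^ k := pow_succ' _ _
    omega
  have hKR : ((2 ^ (k + 1) - 1 : ℕ) : ℝ) = 2 ^ (k + 1) - 1 := by
    rw [Nat.cast_sub (by omega)]; push_cast; ring
  -- The constant is `4K + 2`: `K` each from pivots, `B_1`, `B_2` and products, and 2 from near
  -- edges. The exponent 0 keeps the logarithmic factor equal to 1 even where the logarithm
  -- vanishes.
  refine ⟨4 * ((2 ^ (k + 1) - 1 : ℕ) : ℝ) + 2, 0, fun V _ G pivot hp =>
    ⟨fun ω => ?_, ?_, fun u v huv hle => ?_⟩⟩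
  · have h := Emulator.isEmulator_construction G ω hp hK
    rwa [show 2 ^ (k + 1) - 1 - 2 = 2 ^ (k + 1) - 3 by omega,
      show 2 * (2 ^ (k + 1) - 1) - 2 = 2 ^ (k + 2) - 4 by omega] at h
  · have h := Emulator.expectedSize_le G pivot (K := 2 ^ (k + 1) - 1) (by omega)
    rw [pow_zero, mul_one, ← hKR]
    exact h
  · have hr : G.Reachable u v :=
      SimpleGraph.reachable_of_edist_ne_top (ne_top_of_le_ne_top (ENat.natCast_ne_top _) hle)
    refine ⟨fun ω => ?_, ?_⟩
    · refine (Emulator.wdist_construction_le G ω hp hK hr).trans_eq ?_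
      rw [← ENNReal.ofReal_natCast]
      congr 1
      rw [show 2 ^ (k + 1) - 1 - 2 = 2 ^ (k + 1) - 3 by omega,
        show 2 * (2 ^ (k + 1) - 1) - 2 = 2 ^ (k + 2) - 4 by omega, Nat.cast_add, Nat.cast_mul,
        Nat.cast_sub (by omega), Nat.cast_sub (by omega)]
      push_cast
      ring
    · rw [← hr.coe_dist_eq_edist] at hle
      exact Emulator.comparison_lt_of_le_threshold hk (hr.pos_dist_of_ne huv)
        (by exact_mod_cast hle)
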